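/- Let $\gamma:[0,L]\to\mathbb{R}^2$ be a simple closed curve with $\gamma(0)=\gamma(L)$ and $\gamma'(0)=\gamma'(L)$, parametrized counterclockwise by arc length, of class $C^1$ and piecewise $C^2$. Let $\Omega_\gamma$ be the bounded open set enclosed by $\gamma$, let $A(\gamma)$ be its area, let $k$ be the signed curvature of $\gamma$, and let $E(\gamma)=\frac12\int_0^L k(s)^2\,ds$ be its elastic energy. For distinct points $p,q$ of $\gamma$, the arc of $\gamma$ travelled counterclockwise from $p$ to $q$ is said to hold an open convex set $K\subseteq\Omega_\gamma$ if $\partial K$ is the union of this arc and the straight segment from $p$ to $q$, and the tangent lines to $\gamma$ at $p$ and $q$ are parallel. If $\gamma$ contains two arcs holding two convex sets $K$ and $K'$, respectively, with $K\cap K'=\emptyset$, then $$A(\gamma)\,E(\gamma)^2\ge\pi^3 .$$ -/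

import Mathlib

open Set Filter Topology MeasureTheory

noncomputable section

namespace ElasticCurve

/-- The Euclidean plane. -/
abbrev Plane : Type := EuclideanSpace ℝ (Fin 2)

/-- The tangent vector `t(s) = γ'(s)`. -/
def tangent (γ : ℝ → Plane) (s : ℝ) : Plane := deriv γ s

/-- The normal vector: the tangent turned by `π / 2` counterclockwise, so that `(t, n)` has the
orientation of the canonical basis. -/
def normal (γ : ℝ → Plane) (s : ℝ) : Plane := !₂[-(tangent γ s 1), tangent γ s 0]

/-- The signed curvature of a curve parametrized by arc length, i.e. the coefficient in
`t'(s) = k(s) n(s)`. -/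
def curvature (γ : ℝ → Plane) (s : ℝ) : ℝ := inner ℝ (deriv (tangent γ) s) (normal γ s)

/-- The elastic energy `E(γ) = (1/2) ∫₀ᴸ k(s)² ds`. -/
def elasticEnergy (γ : ℝ → Plane) (L : ℝ) : ℝ := (1 / 2) * ∫ s in (0 : ℝ)..L, curvature γ s ^ 2

/-- The region `Ω_γ` enclosed by the curve: the points off the curve that lie in a bounded connected
component of its complement. -/
def enclosedRegion (γ : ℝ → Plane) : Set Plane :=
  {x | x ∉ range γ ∧ Bornology.IsBounded (connectedComponentIn (range γ)ᶜ x)}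

/-- The enclosed area `A(γ)`. -/
def enclosedArea (γ : ℝ → Plane) : ℝ := (volume (enclosedRegion γ)).toReal

/-- `γ` is piecewise `C²` on `[0, L]`: there are finitely many points `0 = t₀ ≤ … ≤ tₙ = L` such that
`γ` is `C²` on each closed interval `[tᵢ, tᵢ₊₁]` (one-sidedly at its end points). -/
def PiecewiseC2 (γ : ℝ → Plane) (L : ℝ) : Prop :=
  ∃ (n : ℕ) (t : ℕ → ℝ), Monotone t ∧ t 0 = 0 ∧ t n = L ∧
    ∀ i < n, ContDiffOn ℝ 2 γ (Icc (t i) (t (i + 1)))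

/-- `γ` is (the `L`-periodic extension of) a simple regular closed plane curve of length `L`,
parametrized counterclockwise by arc length, of class `C¹` and piecewise `C²`. That the periodic
extension is `C¹` encodes `γ(0) = γ(L)` and `γ'(0) = γ'(L)`. -/
structure IsPositiveSimpleClosedCurve (γ : ℝ → Plane) (L : ℝ) : Prop where
  length_pos : 0 < L
  periodic : Function.Periodic γ L
  simple : InjOn γ (Ico 0 L)
  contDiff : ContDiff ℝ 1 γ
  piecewise_contDiff : PiecewiseC2 γ L
  unit_speed : ∀ s, ‖tangent γ s‖ = 1
  /-- The normal points into the enclosed region. -/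
  counterclockwise : ∀ s, ∀ᶠ ε : ℝ in 𝓝[>] 0, γ s + ε • normal γ s ∈ enclosedRegion γ

/-- The arc of the `L`-periodic closed curve `γ` from `p = γ a` to `q = γ b`, travelled in the direction
of the tangent (`a < b < a + L`; it may pass through `γ 0`), holds the open convex set `K`: `K` lies in
the enclosed region, its boundary consists of the segment `pq` and the arc, and the tangents at `p` and
`q` are parallel (as lines, i.e. the unit tangent vectors agree up to sign). -/
structure ArcHolds (γ : ℝ → Plane) (L a b : ℝ) (K : Set Plane) : Prop where
  lt : a < b
  lt_add : b < a + L
  isOpen : IsOpen K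
  convex : Convex ℝ K
  subset : K ⊆ enclosedRegion γ
  frontier_eq : frontier K = segment ℝ (γ a) (γ b) ∪ γ '' Icc a b
  parallel : tangent γ b = tangent γ a ∨ tangent γ b = -tangent γ a

end ElasticCurve

end

noncomputable section

namespace ElasticCurve

/-! Each cap alone satisfies π³ ≤ 2 |K| I², where I is the integral of k² over its arc; two disjoint
caps are then combined by adding areas and energies.

One cap. Convexity of K gives the curvature a constant sign along the arc, and parallel end tangents
force a turn of at least π. Cut the arc where it has turned by exactly π and put the origin at the
midpoint of the new chord. The arc and its reflection in the origin then bound a symmetric convex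
body of perimeter 2l and area P = ∫ p, with p the support function along the arc. Bonnesen's
inequality P + π p(s)² ≤ 2 l p(s) holds for every s (`IsCap.bonnesen`, by Schmidt's comparison with
a disc). Integrating it in s gives π ∫ p² ≤ l P. Together with Minkowski's formula ∫ k p = l and
Cauchy–Schwarz, l² ≤ I ∫ p², this yields Gage's inequality π l ≤ P I. The isoperimetric inequality π
P ≤ l² turns it into π³ ≤ P I² (`IsCap.pi_cubed_le`). Half of the symmetric body lies in the closure
of K, so P ≤ 2 |K|.

Two caps. Where the arcs overlap, the curve lies on a line separating K from K', so k = 0 there and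
I + I' ≤ 2 E; also |K| + |K'| ≤ A. The elementary bound (x⁻² + y⁻²)(x + y)² ≥ 8 then gives 8 π³ ≤ 2
A (2 E)². -/

theorem ofReal_integral_le_lintegral_ofReal {α : Type*} [MeasurableSpace α] {μ : Measure α}
    {f : α → ℝ} (hf : Integrable f μ) :
    ENNReal.ofReal (∫ x, f x ∂μ) ≤ ∫⁻ x, ENNReal.ofReal (f x) ∂μ := by
  have h := ofReal_integral_eq_lintegral_ofReal hf.pos_part
    (Eventually.of_forall fun x => le_max_right _ _)
  simp only [ENNReal.ofReal_max, ENNReal.ofReal_zero, zero_le, max_eq_left] at h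
  rw [← h]
  exact ENNReal.ofReal_le_ofReal (integral_mono hf hf.pos_part fun x => le_max_left _ _)

/-! ### Schmidt's comparison with a disc -/

theorem integral_sqrt_sq_sub_sq {r : ℝ} (hr : 0 ≤ r) :
    ∫ t in (-r)..r, √(r ^ 2 - t ^ 2) = Real.pi * r ^ 2 / 2 := by
  rcases hr.eq_or_lt with rfl | hr'
  · simp
  have h := intervalIntegral.mul_integral_comp_mul_left (a := -1) (b := 1)
    (f := fun t => √(r ^ 2 - t ^ 2)) r
  have h2 : ∀ t : ℝ, √(r ^ 2 - (r * t) ^ 2) = r * √(1 - t ^ 2) := by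
    intro t
    rw [show r ^ 2 - (r * t) ^ 2 = r ^ 2 * (1 - t ^ 2) by ring, Real.sqrt_mul (by positivity),
      Real.sqrt_sq hr]
  simp only [h2, intervalIntegral.integral_const_mul, integral_sqrt_one_sub_sq, mul_neg,
    mul_one] at h
  rw [← h]; ring

/-- Schmidt's comparison with a disc: a curve `(x, y)` whose abscissa increases up to its maximum
`r` at `s` and decreases afterwards, with opposite abscissas at its ends. -/
theorem schmidt_comparison {x ω : ℝ → ℝ} {a s b : ℝ}
    (hx : ∀ u, HasDerivAt x (-Real.sin (ω u)) u) (hω : Continuous ω)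
    (has : a ≤ s) (hsb : s ≤ b)
    (hneg : ∀ u ∈ Icc a s, Real.sin (ω u) ≤ 0) (hpos : ∀ u ∈ Icc s b, 0 ≤ Real.sin (ω u))
    (hab : x b = -x a) :
    (∫ u in a..b, x u * Real.cos (ω u)) + Real.pi * x s ^ 2 / 2 ≤ x s * (b - a) := by
  have cx : Continuous x := continuous_iff_continuousAt.2 fun u => (hx u).continuousAt
  have hmono : MonotoneOn x (Icc a s) := by
    apply monotoneOn_of_deriv_nonneg (convex_Icc a s) cx.continuousOn
    · exact fun u _ => (hx u).differentiableAt.differentiableWithinAt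
    · intro u hu
      rw [(hx u).deriv]
      linarith [hneg u (interior_subset hu)]
  have hanti : AntitoneOn x (Icc s b) := by
    apply antitoneOn_of_deriv_nonpos (convex_Icc s b) cx.continuousOn
    · exact fun u _ => (hx u).differentiableAt.differentiableWithinAt
    · intro u hu
      rw [(hx u).deriv]
      linarith [hpos u (interior_subset hu)]
  set r := x s with hr
  have ha : x a ≤ r := hmono ⟨le_rfl, has⟩ ⟨has, le_rfl⟩ has
  have hb : x b ≤ r := hanti ⟨le_rfl, hsb⟩ ⟨hsb, le_rfl⟩ hsb
  have hr0 : 0 ≤ r := by linarith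
  have habs : ∀ u ∈ Icc a b, x u ^ 2 ≤ r ^ 2 := by
    intro u hu
    rw [sq_le_sq, abs_of_nonneg hr0, abs_le]
    rcases le_total u s with h | h
    · exact ⟨by linarith [hmono ⟨le_rfl, has⟩ ⟨hu.1, h⟩ hu.1],
        hmono ⟨hu.1, h⟩ ⟨has, le_rfl⟩ h⟩
    · exact ⟨by linarith [hanti ⟨h, hu.2⟩ ⟨hsb, le_rfl⟩ hu.2],
        hanti ⟨le_rfl, hsb⟩ ⟨h, hu.2⟩ h⟩
  -- Cauchy–Schwarz for the vector (x, w) of length r and the unit tangent. The root w is positive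
  -- before `s` and negative after it, so that (x, w) runs along the circle of radius r.
  have key : ∀ u ∈ Icc a b, ∀ w : ℝ, w ^ 2 = r ^ 2 - x u ^ 2 →
      x u * Real.cos (ω u) + w * (-Real.sin (ω u)) ≤ r := by
    intro u hu w hw
    have := Real.sin_sq_add_cos_sq (ω u)
    apply abs_le_of_sq_le_sq' _ hr0 |>.2
    have hid : r ^ 2 = x u ^ 2 + w ^ 2 := by linarith
    rw [hid]
    nlinarith [sq_nonneg (x u * Real.sin (ω u) + w * Real.cos (ω u))]
  have csin : Continuous fun u => -Real.sin (ω u) := by fun_prop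
  have csq : Continuous fun t => √(r ^ 2 - t ^ 2) := by fun_prop
  have sub : ∀ c d, ∫ u in c..d, √(r ^ 2 - x u ^ 2) * (-Real.sin (ω u))
      = ∫ t in (x c)..(x d), √(r ^ 2 - t ^ 2) := fun c d =>
    intervalIntegral.integral_comp_mul_deriv (fun u _ => hx u) csin.continuousOn csq
  have I : ∀ (f : ℝ → ℝ), Continuous f → ∀ c d, IntervalIntegrable f volume c d :=
    fun f hf c d => hf.intervalIntegrable c d
  have cc : Continuous fun u => x u * Real.cos (ω u) := by fun_prop
  have cs : Continuous fun u => √(r ^ 2 - x u ^ 2) * (-Real.sin (ω u)) := by fun_prop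
  have h1 : (∫ u in a..s, x u * Real.cos (ω u)) + ∫ t in (x a)..r, √(r ^ 2 - t ^ 2)
      ≤ r * (s - a) := by
    rw [hr, ← sub, ← intervalIntegral.integral_add (I _ cc _ _) (I _ cs _ _)]
    refine (intervalIntegral.integral_mono_on (g := fun _ => r) has (I _ (cc.add cs) _ _)
      (I _ continuous_const _ _) fun u hu => key u ⟨hu.1, hu.2.trans hsb⟩ _ ?_).trans ?_
    · exact Real.sq_sqrt (by linarith [habs u ⟨hu.1, hu.2.trans hsb⟩])
    · rw [intervalIntegral.integral_const, smul_eq_mul, mul_comm]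
  have h2 : (∫ u in s..b, x u * Real.cos (ω u)) - ∫ t in r..(x b), √(r ^ 2 - t ^ 2)
      ≤ r * (b - s) := by
    rw [hr, ← sub, ← intervalIntegral.integral_sub (I _ cc _ _) (I _ cs _ _)]
    refine (intervalIntegral.integral_mono_on (g := fun _ => r) hsb (I _ (cc.sub cs) _ _)
      (I _ continuous_const _ _) fun u hu => ?_).trans ?_
    · have := key u ⟨has.trans hu.1, hu.2⟩ (-√(r ^ 2 - x u ^ 2)) (by
        rw [neg_sq]; exact Real.sq_sqrt (by linarith [habs u ⟨has.trans hu.1, hu.2⟩]))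
      change x u * Real.cos (ω u) - √(r ^ 2 - x u ^ 2) * -Real.sin (ω u) ≤ r
      linarith
    · rw [intervalIntegral.integral_const, smul_eq_mul, mul_comm]
  -- Since x b = -x a, the parts of the half disc swept before and after `s` fit together, after a
  -- reflection, to exactly one half disc.
  have h3 : ∫ t in r..(x b), √(r ^ 2 - t ^ 2) = -∫ t in (-r)..(x a), √(r ^ 2 - t ^ 2) := by
    have := intervalIntegral.integral_comp_neg (a := -r) (b := x a)
      (fun t => √(r ^ 2 - t ^ 2))
    simp only [neg_sq, neg_neg] at this
    rw [this, ← hab, intervalIntegral.integral_symm]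
  have h4 := intervalIntegral.integral_add_adjacent_intervals (I _ csq (-r) (x a)) (I _ csq (x a) r)
  rw [integral_sqrt_sq_sub_sq hr0] at h4
  have h5 := intervalIntegral.integral_add_adjacent_intervals (I _ cc a s) (I _ cc s b)
  linarith

/-! ### Caps turning by π: the inequalities of Bonnesen and Gage -/

/-- An arc parametrized by arc length, with tangent `(sin ψ, -cos ψ)` turning monotonically from
`ψ = 0` to `ψ = π`, and with end points symmetric about the origin. -/
structure IsCap (X Y ψ : ℝ → ℝ) (a b : ℝ) : Prop where
  lt : a < b
  cont : Continuous ψ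
  hasDerivAt_fst : ∀ u, HasDerivAt X (Real.sin (ψ u)) u
  hasDerivAt_snd : ∀ u, HasDerivAt Y (-Real.cos (ψ u)) u
  mono : MonotoneOn ψ (Icc a b)
  angle_left : ψ a = 0
  angle_right : ψ b = Real.pi
  symm_fst : X b = -X a
  symm_snd : Y b = -Y a

/-- The distance from the origin to the tangent line. -/
def supportFn (X Y ψ : ℝ → ℝ) (u : ℝ) : ℝ := -(X u * Real.cos (ψ u) + Y u * Real.sin (ψ u))

namespace IsCap

variable {X Y ψ : ℝ → ℝ} {a b : ℝ} (h : IsCap X Y ψ a b)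
include h

theorem continuous_fst : Continuous X :=
  continuous_iff_continuousAt.2 fun u => (h.hasDerivAt_fst u).continuousAt

theorem continuous_snd : Continuous Y :=
  continuous_iff_continuousAt.2 fun u => (h.hasDerivAt_snd u).continuousAt

theorem continuous_supportFn : Continuous (supportFn X Y ψ) := by
  have := h.continuous_fst
  have := h.continuous_snd
  have := h.cont
  unfold supportFn
  fun_prop

theorem angle_mem {u : ℝ} (hu : u ∈ Icc a b) : ψ u ∈ Icc 0 Real.pi := by
  constructor
  · rw [← h.angle_left]; exact h.mono ⟨le_rfl, h.lt.le⟩ hu hu.1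
  · rw [← h.angle_right]; exact h.mono hu ⟨h.lt.le, le_rfl⟩ hu.2

/-- The Bonnesen inequality for the symmetric body whose boundary is the arc and its reflection. -/
theorem bonnesen {s : ℝ} (hs : s ∈ Icc a b) :
    (∫ u in a..b, supportFn X Y ψ u) + Real.pi * supportFn X Y ψ s ^ 2
      ≤ 2 * supportFn X Y ψ s * (b - a) := by
  set c := Real.cos (ψ s)
  set d := Real.sin (ψ s)
  have hcd : d ^ 2 + c ^ 2 = 1 := Real.sin_sq_add_cos_sq (ψ s)
  have cX := h.continuous_fst
  have cY := h.continuous_snd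
  have cψ := h.cont
  let x : ℝ → ℝ := fun u => -(X u * c + Y u * d)
  let y : ℝ → ℝ := fun u => X u * d - Y u * c
  have hx : ∀ u, HasDerivAt x (-Real.sin (ψ u - ψ s)) u := by
    intro u
    refine (((h.hasDerivAt_fst u).mul_const c).add
      ((h.hasDerivAt_snd u).mul_const d)).neg.congr_deriv ?_
    rw [Real.sin_sub]; ring
  have hy : ∀ u, HasDerivAt y (Real.cos (ψ u - ψ s)) u := by
    intro u
    refine (((h.hasDerivAt_fst u).mul_const d).sub
      ((h.hasDerivAt_snd u).mul_const c)).congr_deriv ?_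
    rw [Real.cos_sub]; ring
  have key := schmidt_comparison (ω := fun u => ψ u - ψ s) hx (by fun_prop)
    hs.1 hs.2 ?_ ?_ (by simp only [x, h.symm_fst, h.symm_snd]; ring)
  -- In the frame turned by ψ(s), x and y both change sign between the end points, so d(xy)
  -- integrates to zero and ∫ p = ∫ (x dy - y dx) = 2 ∫ x dy.
  · have e1 : (∫ u in a..b, (x u * Real.cos (ψ u - ψ s) + -Real.sin (ψ u - ψ s) * y u))
        = 0 := by
      have c1 : Continuous fun u => -Real.sin (ψ u - ψ s) := by fun_prop
      have c2 : Continuous fun u => Real.cos (ψ u - ψ s) := by fun_prop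
      have := intervalIntegral.integral_deriv_mul_eq_sub (a := a) (b := b) (fun u _ => hx u)
        (fun u _ => hy u) (c1.intervalIntegrable _ _) (c2.intervalIntegrable _ _)
      rw [show (fun u => x u * Real.cos (ψ u - ψ s) + -Real.sin (ψ u - ψ s) * y u)
        = fun u => -Real.sin (ψ u - ψ s) * y u + x u * Real.cos (ψ u - ψ s) by
          ext u; ring, this]
      simp only [x, y, h.symm_fst, h.symm_snd]; ring
    have e2 : ∀ u, supportFn X Y ψ u = 2 * (x u * Real.cos (ψ u - ψ s)) -
        (x u * Real.cos (ψ u - ψ s) + -Real.sin (ψ u - ψ s) * y u) := by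
      intro u
      simp only [x, y, supportFn, Real.sin_sub, Real.cos_sub]
      linear_combination (-(X u * Real.cos (ψ u) + Y u * Real.sin (ψ u))) * (-hcd)
    have e3 : (∫ u in a..b, supportFn X Y ψ u)
        = 2 * ∫ u in a..b, x u * Real.cos (ψ u - ψ s) := by
      simp only [e2]
      rw [intervalIntegral.integral_sub, e1, intervalIntegral.integral_const_mul, sub_zero]
      · exact Continuous.intervalIntegrable (by fun_prop) _ _
      · exact Continuous.intervalIntegrable (by fun_prop) _ _
    have e4 : supportFn X Y ψ s = x s := rfl
    rw [e3, e4]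
    linarith
  · intro u hu
    have h1 := h.mono ⟨hu.1, hu.2.trans hs.2⟩ hs hu.2
    have h2 := h.angle_mem ⟨hu.1, hu.2.trans hs.2⟩
    have h3 := h.angle_mem hs
    exact Real.sin_nonpos_of_nonpos_of_neg_pi_le (by linarith) (by linarith [h2.1, h3.2])
  · intro u hu
    have h1 := h.mono hs ⟨hs.1.trans hu.1, hu.2⟩ hu.1
    have h2 := h.angle_mem ⟨hs.1.trans hu.1, hu.2⟩
    have h3 := h.angle_mem hs
    exact Real.sin_nonneg_of_nonneg_of_le_pi (by linarith) (by linarith [h2.2, h3.1])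

/-- Minkowski's formula: the component of the position along the tangent has derivative 1 - κ p, and
the symmetry of the end points gives it equal values at both ends. -/
theorem integral_supportFn_mul {κ : ℝ → ℝ} {S : Set ℝ} (hS : S.Countable)
    (hκ : ∀ u ∉ S, HasDerivAt ψ (κ u) u) (iκ : IntervalIntegrable κ volume a b) :
    ∫ u in a..b, κ u * supportFn X Y ψ u = b - a := by
  have cX := h.continuous_fst
  have cY := h.continuous_snd
  have cψ := h.cont
  have ip : IntervalIntegrable (fun u => κ u * supportFn X Y ψ u) volume a b :=
    iκ.mul_continuousOn h.continuous_supportFn.continuousOn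
  have key := integral_eq_of_hasDerivAt_off_countable_of_le
    (fun u => X u * Real.sin (ψ u) - Y u * Real.cos (ψ u))
    (fun u => 1 - κ u * supportFn X Y ψ u) h.lt.le hS
    (Continuous.continuousOn (by fun_prop)) ?_ ((intervalIntegrable_const (μ := volume) (c := (1 : ℝ))).sub ip)
  · rw [intervalIntegral.integral_sub intervalIntegrable_const ip] at key
    simp only [h.angle_left, h.angle_right, h.symm_snd, Real.sin_pi, Real.cos_pi, Real.sin_zero,
      Real.cos_zero, intervalIntegral.integral_const, smul_eq_mul] at key
    linarith
  · intro u hu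
    refine (((h.hasDerivAt_fst u).mul (hκ u hu.2).sin).sub
      ((h.hasDerivAt_snd u).mul (hκ u hu.2).cos)).congr_deriv ?_
    have := Real.sin_sq_add_cos_sq (ψ u)
    simp only [supportFn]
    linear_combination this

/-- Gage's argument: Bonnesen's inequality integrated along the arc, Minkowski's formula with
Cauchy–Schwarz, and the isoperimetric inequality. -/
theorem pi_cubed_le {κ : ℝ → ℝ} {S : Set ℝ} (hS : S.Countable)
    (hκ : ∀ u ∉ S, HasDerivAt ψ (κ u) u) (iκ : IntervalIntegrable κ volume a b)
    (iκ2 : IntervalIntegrable (fun u => κ u ^ 2) volume a b) :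
    0 < (∫ u in a..b, supportFn X Y ψ u) ∧ 0 < (∫ u in a..b, κ u ^ 2) ∧
    Real.pi ^ 3 ≤ (∫ u in a..b, supportFn X Y ψ u) * (∫ u in a..b, κ u ^ 2) ^ 2 := by
  set p := supportFn X Y ψ
  have cp : Continuous p := h.continuous_supportFn
  set P := ∫ u in a..b, p u
  set I := ∫ u in a..b, κ u ^ 2
  set Q := ∫ u in a..b, p u ^ 2
  set l := b - a
  have hl : 0 < l := sub_pos.2 h.lt
  have hab := h.lt.le
  have hπ := Real.pi_pos
  have hI : 0 ≤ I := intervalIntegral.integral_nonneg hab fun u _ => sq_nonneg _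
  have hQ : 0 ≤ Q := intervalIntegral.integral_nonneg hab fun u _ => sq_nonneg _
  have h1 : Real.pi * Q ≤ l * P := by
    have c1 : IntervalIntegrable (fun _ : ℝ => P) volume a b := intervalIntegrable_const
    have c2 : IntervalIntegrable (fun u => Real.pi * p u ^ 2) volume a b :=
      Continuous.intervalIntegrable (by fun_prop) _ _
    have c3 : IntervalIntegrable (fun u => 2 * p u * l) volume a b :=
      Continuous.intervalIntegrable (by fun_prop) _ _
    have := intervalIntegral.integral_mono_on (f := fun u => P + Real.pi * p u ^ 2)
      (g := fun u => 2 * p u * l) hab (c1.add c2) c3 fun u hu => h.bonnesen hu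
    rw [intervalIntegral.integral_add c1 c2, intervalIntegral.integral_const_mul,
      intervalIntegral.integral_mul_const, intervalIntegral.integral_const_mul,
      intervalIntegral.integral_const, smul_eq_mul] at this
    change l * P + Real.pi * Q ≤ 2 * P * l at this
    linarith
  -- This is ∫ (c κ - p)² ≥ 0; its discriminant in c gives the Cauchy–Schwarz inequality `h3`.
  have h2 : ∀ c : ℝ, 0 ≤ c ^ 2 * I - 2 * c * l + Q := by
    intro c
    have ip := (iκ.mul_continuousOn h.continuous_supportFn.continuousOn).const_mul (2 * c)
    have ik := iκ2.const_mul (c ^ 2)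
    have iq : IntervalIntegrable (fun u => p u ^ 2) volume a b :=
      Continuous.intervalIntegrable (by fun_prop) _ _
    have e : ∫ u in a..b, (c ^ 2 * κ u ^ 2 - 2 * c * (κ u * p u) + p u ^ 2)
        = c ^ 2 * I - 2 * c * l + Q := by
      rw [intervalIntegral.integral_add (ik.sub ip) iq, intervalIntegral.integral_sub ik ip,
        intervalIntegral.integral_const_mul, intervalIntegral.integral_const_mul,
        h.integral_supportFn_mul hS hκ iκ]
    rw [← e]
    refine intervalIntegral.integral_nonneg hab fun u _ => ?_
    nlinarith [sq_nonneg (c * κ u - p u)]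
  have h3 : l ^ 2 ≤ I * Q := by
    have := discrim_le_zero (a := I) (b := -2 * l) (c := Q) fun c => by
      have := h2 c; linarith
    rw [discrim] at this
    linarith
  -- Bonnesen's inequality at any single point implies the isoperimetric one, by completing the
  -- square in p.
  have h4 : Real.pi * P ≤ l ^ 2 := by
    have := h.bonnesen (s := a) ⟨le_rfl, hab⟩
    change P + Real.pi * p a ^ 2 ≤ 2 * p a * l at this
    nlinarith [sq_nonneg (Real.pi * p a - l)]
  have h5 : Real.pi * l ≤ P * I := by
    have : l * (Real.pi * l) ≤ l * (P * I) := by nlinarith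
    exact le_of_mul_le_mul_left this hl
  have hPI : 0 < P * I := lt_of_lt_of_le (by positivity) h5
  have hI' : 0 < I := hI.lt_of_ne fun h0 => by rw [← h0, mul_zero] at hPI; exact hPI.false
  have hP : 0 < P := pos_of_mul_pos_left hPI hI
  refine ⟨hP, hI', ?_⟩
  have h6 : (Real.pi * l) ^ 2 ≤ (P * I) ^ 2 := pow_le_pow_left₀ (by positivity) h5 2
  have : P * Real.pi ^ 3 ≤ P * (P * I ^ 2) := by nlinarith [sq_nonneg Real.pi]
  exact le_of_mul_le_mul_left this hP

/-- A convex set containing the arc has at least the area under it. -/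
theorem area_le {C : Set (ℝ × ℝ)} (hC : Convex ℝ C) (hm : MeasurableSet C)
    (hsub : ∀ u ∈ Icc a b, (X u, Y u) ∈ C) :
    ENNReal.ofReal ((∫ u in a..b, supportFn X Y ψ u) / 2) ≤ volume C := by
  have cX := h.continuous_fst
  have cY := h.continuous_snd
  have cψ := h.cont
  have hsin : ∀ u ∈ Icc a b, 0 ≤ Real.sin (ψ u) := fun u hu =>
    Real.sin_nonneg_of_nonneg_of_le_pi (h.angle_mem hu).1 (h.angle_mem hu).2
  have hmono : MonotoneOn X (Icc a b) := by
    apply monotoneOn_of_deriv_nonneg (convex_Icc a b) cX.continuousOn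
    · exact fun u _ => (h.hasDerivAt_fst u).differentiableAt.differentiableWithinAt
    · intro u hu
      rw [(h.hasDerivAt_fst u).deriv]
      exact hsin u (interior_subset hu)
  have hX : ∀ u ∈ Icc a b, X a ≤ X u ∧ X u ≤ X b := fun u hu =>
    ⟨hmono ⟨le_rfl, h.lt.le⟩ hu hu.1, hmono hu ⟨h.lt.le, le_rfl⟩ hu.2⟩
  have hpos : 0 < X b := by
    have hint : ∫ u in a..b, Real.sin (ψ u) = X b - X a :=
      intervalIntegral.integral_eq_sub_of_hasDerivAt (fun u _ => h.hasDerivAt_fst u)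
        (Continuous.intervalIntegrable (by fun_prop) _ _)
    obtain ⟨c, hc, hcπ⟩ := intermediate_value_Icc h.lt.le cψ.continuousOn
      (show Real.pi / 2 ∈ Icc (ψ a) (ψ b) by
        rw [h.angle_left, h.angle_right]; constructor <;> linarith [Real.pi_pos])
    have : 0 < ∫ u in a..b, Real.sin (ψ u) :=
      intervalIntegral.integral_pos h.lt (Continuous.continuousOn (by fun_prop))
        (fun u hu => hsin u (Ioc_subset_Icc_self hu)) ⟨c, hc, by rw [hcπ]; simp⟩
    rw [hint, h.symm_fst] at this
    rw [h.symm_fst]; linarith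
  -- Slope of the chord, which passes through the origin by symmetry.
  set m := Y b / X b with hmdef
  have hchord : ∀ u ∈ Icc a b, (X u, m * X u) ∈ C := by
    intro u hu
    have := hC (hsub a ⟨le_rfl, h.lt.le⟩) (hsub b ⟨h.lt.le, le_rfl⟩)
      (a := (X b - X u) / (2 * X b)) (b := (X b + X u) / (2 * X b))
      (div_nonneg (by linarith [hX u hu]) (by linarith))
      (div_nonneg (by linarith [hX u hu, h.symm_fst]) (by linarith))
      (by field_simp; ring)
    convert this using 1
    have ha : X a = -X b := by linarith [h.symm_fst]
    have hb : Y a = -Y b := by linarith [h.symm_snd]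
    simp only [ha, hb, Prod.smul_mk, Prod.mk_add_mk, smul_eq_mul, hmdef]
    congr 1 <;> (field_simp; ring)
  -- The vertical slice of `C` contains the segment from the arc up to the chord. `ENNReal.ofReal`
  -- truncates at zero, so the sign of m X - Y need not be known.
  have hsec : ∀ u ∈ Icc a b,
      ENNReal.ofReal (m * X u - Y u) ≤ volume (Prod.mk (X u) ⁻¹' C) := by
    intro u hu
    rw [← Real.volume_Icc]
    refine measure_mono fun z hz => ?_
    have hle : Y u ≤ m * X u := hz.1.trans hz.2
    have hseg : z ∈ segment ℝ (Y u) (m * X u) := by rwa [segment_eq_Icc hle]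
    obtain ⟨α, β, hα, hβ, hαβ, rfl⟩ := hseg
    have := hC (hsub u hu) (hchord u hu) hα hβ hαβ
    rw [Prod.smul_mk, Prod.smul_mk, Prod.mk_add_mk, ← add_smul, hαβ, one_smul] at this
    exact this
  -- Twice the left integrand minus p is the derivative of m X² - X Y, which is unchanged when (X,
  -- Y) is replaced by its opposite.
  have e1 : (∫ u in a..b, Real.sin (ψ u) * (m * X u - Y u))
      = (∫ u in a..b, supportFn X Y ψ u) / 2 := by
    have := intervalIntegral.integral_eq_sub_of_hasDerivAt (a := a) (b := b)
      (f := fun u => m * X u ^ 2 - X u * Y u)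
      (f' := fun u => 2 * (Real.sin (ψ u) * (m * X u - Y u)) - supportFn X Y ψ u)
      (fun u _ => by
        refine ((((h.hasDerivAt_fst u).pow 2).const_mul m).sub
          ((h.hasDerivAt_fst u).mul (h.hasDerivAt_snd u))).congr_deriv ?_
        simp only [supportFn]; push_cast; ring)
      (((Continuous.intervalIntegrable (by fun_prop) _ _)).sub
        (h.continuous_supportFn.intervalIntegrable _ _))
    rw [intervalIntegral.integral_sub (Continuous.intervalIntegrable (by fun_prop) _ _)
      (h.continuous_supportFn.intervalIntegrable _ _), intervalIntegral.integral_const_mul,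
      h.symm_fst, h.symm_snd] at this
    linarith
  rw [← e1, Measure.volume_eq_prod, Measure.prod_apply hm]
  calc ENNReal.ofReal (∫ u in a..b, Real.sin (ψ u) * (m * X u - Y u))
      ≤ ∫⁻ u in Icc a b, ENNReal.ofReal (Real.sin (ψ u) * (m * X u - Y u)) := by
        rw [intervalIntegral.integral_of_le h.lt.le, ← integral_Icc_eq_integral_Ioc]
        exact ofReal_integral_le_lintegral_ofReal
          (Continuous.integrableOn_Icc (by fun_prop))
    _ ≤ ∫⁻ u in Icc a b, ENNReal.ofReal (Real.sin (ψ u)) * volume (Prod.mk (X u) ⁻¹' C) := by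
        refine setLIntegral_mono' measurableSet_Icc fun u hu => ?_
        rw [ENNReal.ofReal_mul (hsin u hu)]
        gcongr
        exact hsec u hu
    _ = ∫⁻ x in X '' Icc a b, volume (Prod.mk x ⁻¹' C) :=
        (lintegral_image_eq_lintegral_deriv_mul_of_monotoneOn measurableSet_Icc
          (fun u _ => (h.hasDerivAt_fst u).hasDerivWithinAt) hmono
          fun x => volume (Prod.mk x ⁻¹' C)).symm
    _ ≤ ∫⁻ x, volume (Prod.mk x ⁻¹' C) := setLIntegral_le_lintegral _ _

end IsCap

/-! ### Tangent, curvature and turning angle of a piecewise C² curve -/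

theorem mem_range_or_mem_Ioo_of_mem_Icc {t : ℕ → ℝ} {u : ℝ} (n : ℕ) (h : u ∈ Icc (t 0) (t n)) :
    u ∈ range t ∨ ∃ i < n, u ∈ Ioo (t i) (t (i + 1)) := by
  induction n with
  | zero => exact Or.inl ⟨0, le_antisymm h.1 h.2⟩
  | succ n ih =>
    rcases le_or_gt u (t n) with hu | hu
    · exact (ih ⟨h.1, hu⟩).imp_right fun ⟨i, hi, hiu⟩ => ⟨i, hi.trans n.lt_succ_self, hiu⟩
    · rcases h.2.eq_or_lt with hu' | hu'
      · exact Or.inl ⟨n + 1, hu'.symm⟩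
      · exact Or.inr ⟨n, n.lt_succ_self, hu, hu'⟩

theorem curvature_eq (γ : ℝ → Plane) (s : ℝ) : curvature γ s =
    tangent γ s 0 * deriv (tangent γ) s 1 - tangent γ s 1 * deriv (tangent γ) s 0 := by
  simp [curvature, normal, PiLp.inner_apply, Fin.sum_univ_two]
  ring

/-- The parameters at which the curve fails to be `C²`. -/
def singularSet (γ : ℝ → Plane) : Set ℝ := {u | ¬ContDiffAt ℝ 2 γ u}

theorem contDiffAt_tangent {γ : ℝ → Plane} {u : ℝ} (hu : u ∉ singularSet γ) :
    ContDiffAt ℝ 1 (tangent γ) u := by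
  have h : ContDiffAt ℝ 2 γ u := not_not.1 hu
  have h1 : ContDiffAt ℝ 1 (fderiv ℝ γ) u := h.fderiv_right (by norm_num)
  have h2 : tangent γ = fun s => fderiv ℝ γ s 1 := by
    ext1 s; exact fderiv_apply_one_eq_deriv.symm
  rw [h2]
  exact h1.clm_apply contDiffAt_const

theorem hasDerivAt_tangent {γ : ℝ → Plane} {u : ℝ} (hu : u ∉ singularSet γ) :
    HasDerivAt (tangent γ) (deriv (tangent γ) u) u :=
  ((contDiffAt_tangent hu).differentiableAt (by norm_num)).hasDerivAt

theorem hasDerivAt_apply {f : ℝ → Plane} {f' : Plane} {u : ℝ} (h : HasDerivAt f f' u)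
    (i : Fin 2) : HasDerivAt (fun s => f s i) (f' i) u :=
  ((EuclideanSpace.proj (𝕜 := ℝ) i).hasFDerivAt.comp_hasDerivAt u h)

theorem continuousAt_curvature {γ : ℝ → Plane} {u : ℝ} (hu : u ∉ singularSet γ) :
    ContinuousAt (curvature γ) u := by
  have h1 := contDiffAt_tangent hu
  have c1 : ContinuousAt (deriv (tangent γ)) u := by
    have h2 : deriv (tangent γ) = fun s => fderiv ℝ (tangent γ) s 1 := by
      ext1 s; exact fderiv_apply_one_eq_deriv.symm
    rw [h2]
    exact ((h1.fderiv_right (m := 0) (by norm_num)).clm_apply contDiffAt_const).continuousAt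
  have c0 : ContinuousAt (tangent γ) u := h1.continuousAt
  have e : ∀ i : Fin 2, Continuous fun v : Plane => v i := fun i =>
    (EuclideanSpace.proj (𝕜 := ℝ) i).continuous
  have hk : curvature γ = fun s => tangent γ s 0 * deriv (tangent γ) s 1 -
    tangent γ s 1 * deriv (tangent γ) s 0 := funext (curvature_eq γ)
  rw [hk]
  exact (((e 0).continuousAt.comp c0).mul ((e 1).continuousAt.comp c1)).sub
    (((e 1).continuousAt.comp c0).mul ((e 0).continuousAt.comp c1))

/-- Rotating (x, y) back by the angle φ gives continuous functions with zero derivative off a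
countable set, hence constants. -/
theorem eq_rotation_of_hasDerivAt {x y φ k : ℝ → ℝ} {S : Set ℝ} {a : ℝ} (hS : S.Countable)
    (cx : Continuous x) (cy : Continuous y) (cφ : Continuous φ) (h0 : φ a = 0)
    (hd : ∀ u ∉ S, HasDerivAt φ (k u) u) (hx : ∀ u ∉ S, HasDerivAt x (-(k u * y u)) u)
    (hy : ∀ u ∉ S, HasDerivAt y (k u * x u) u) (s : ℝ) :
    x s = x a * Real.cos (φ s) - y a * Real.sin (φ s) ∧
      y s = x a * Real.sin (φ s) + y a * Real.cos (φ s) := by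
  have cst : ∀ f : ℝ → ℝ, Continuous f → (∀ u ∉ S, HasDerivAt f 0 u) → f s = f a := by
    intro f hf hf'
    have := integral_eq_of_hasDerivAt_off_countable f (fun _ => 0) (a := a) (b := s)
      hS hf.continuousOn (fun u hu => hf' u hu.2) (by simp)
    simp only [intervalIntegral.integral_zero] at this
    linarith
  have F := cst (fun s => x s * Real.cos (φ s) + y s * Real.sin (φ s))
    (by fun_prop) fun u hu => by
      refine (((hx u hu).mul (hd u hu).cos).add ((hy u hu).mul (hd u hu).sin)).congr_deriv ?_
      ring
  have G := cst (fun s => y s * Real.cos (φ s) - x s * Real.sin (φ s))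
    (by fun_prop) fun u hu => by
      refine (((hy u hu).mul (hd u hu).cos).sub ((hx u hu).mul (hd u hu).sin)).congr_deriv ?_
      ring
  simp only [h0, Real.cos_zero, Real.sin_zero, mul_one, mul_zero, add_zero, sub_zero] at F G
  have h1 := Real.sin_sq_add_cos_sq (φ s)
  constructor
  · rw [← F, ← G]; linear_combination (-x s) * h1
  · rw [← F, ← G]; linear_combination (-y s) * h1

namespace IsPositiveSimpleClosedCurve

variable {γ : ℝ → Plane} {L : ℝ} (hγ : IsPositiveSimpleClosedCurve γ L)
include hγ

theorem continuous : Continuous γ := hγ.contDiff.continuous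

theorem hasDerivAt (s : ℝ) : HasDerivAt γ (tangent γ s) s :=
  (hγ.contDiff.differentiable (by norm_num) s).hasDerivAt

theorem continuous_tangent : Continuous (tangent γ) := hγ.contDiff.continuous_deriv le_rfl

theorem continuous_tangent_apply (i : Fin 2) : Continuous fun s => tangent γ s i :=
  (EuclideanSpace.proj (𝕜 := ℝ) i).continuous.comp hγ.continuous_tangent

theorem tangent_sq (s : ℝ) : tangent γ s 0 ^ 2 + tangent γ s 1 ^ 2 = 1 := by
  have := EuclideanSpace.norm_sq_eq (tangent γ s)
  rw [hγ.unit_speed s, Fin.sum_univ_two, Real.norm_eq_abs, Real.norm_eq_abs, sq_abs, sq_abs] at this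
  linarith

theorem periodic_tangent : Function.Periodic (tangent γ) L := by
  intro s
  have : (fun u => γ (u + L)) = γ := funext hγ.periodic
  rw [tangent, tangent, ← deriv_comp_add_const, this]

theorem periodic_curvature : Function.Periodic (curvature γ) L := by
  intro s
  have : (fun u => tangent γ (u + L)) = tangent γ := funext hγ.periodic_tangent
  have h : deriv (tangent γ) (s + L) = deriv (tangent γ) s := by
    rw [← deriv_comp_add_const, this]
  rw [curvature_eq, curvature_eq, h, hγ.periodic_tangent]

theorem countable_singularSet : (singularSet γ).Countable := by
  obtain ⟨n, t, -, h0, hn, hc⟩ := hγ.piecewise_contDiff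
  have hsub : singularSet γ ⊆ ⋃ (i : ℕ) (j : ℤ), {t i + j * L} := by
    intro u hu
    have hL := hγ.length_pos
    set j : ℤ := ⌊u / L⌋
    have hper : (fun v => γ (v + j * L)) = γ := funext fun v => hγ.periodic.int_mul j v
    have hmem : u - j * L ∈ Icc (t 0) (t n) := by
      rw [h0, hn]
      have h1 := (le_div_iff₀ hL).1 (Int.floor_le (u / L))
      have h2 := (div_lt_iff₀ hL).1 (Int.lt_floor_add_one (u / L))
      constructor <;> linarith
    rcases mem_range_or_mem_Ioo_of_mem_Icc n hmem with ⟨i, hi⟩ | ⟨i, hi, hu'⟩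
    · exact mem_iUnion₂.2 ⟨i, j, by rw [mem_singleton_iff, hi]; ring⟩
    · refine absurd ?_ hu
      have hcd := (hc i hi).contDiffAt (Icc_mem_nhds hu'.1 hu'.2)
      have e : γ = fun v => γ (v - j * L) := by
        conv_rhs => rw [← hper]
        ext1 v; simp
      rw [e]
      exact ContDiffAt.comp u hcd (contDiffAt_id.sub contDiffAt_const)
  exact (countable_iUnion fun i => countable_iUnion fun j => countable_singleton _).mono hsub

/-- On each open piece the curvature agrees with a function continuous up to the end points, built
from one-sided derivatives; its values at the breakpoints do not matter. -/
theorem intervalIntegrable_comp_curvature {F : ℝ → ℝ} (hF : Continuous F) (a b : ℝ) :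
    IntervalIntegrable (fun s => F (curvature γ s)) volume a b := by
  have hp : Function.Periodic (fun s => F (curvature γ s)) L := fun s => by
    simp only [hγ.periodic_curvature s]
  refine hp.intervalIntegrable₀ hγ.length_pos.ne' ?_ a b
  obtain ⟨n, t, hmono, h0, hn, hc⟩ := hγ.piecewise_contDiff
  rw [← h0, ← hn]
  refine IntervalIntegrable.trans_iterate fun i hi => ?_
  rcases (hmono i.le_succ).eq_or_lt with he | hlt
  · rw [← Nat.succ_eq_add_one, ← he]
  set I := Icc (t i) (t (i + 1))
  have hu : UniqueDiffOn ℝ I := uniqueDiffOn_Icc hlt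
  have h1 : ContDiffOn ℝ 1 (derivWithin γ I) I := (hc i hi).derivWithin hu (by norm_num)
  have h2 : ContinuousOn (derivWithin (derivWithin γ I) I) I :=
    h1.continuousOn_derivWithin hu le_rfl
  have e : ∀ i : Fin 2, Continuous fun v : Plane => v i := fun i =>
    (EuclideanSpace.proj (𝕜 := ℝ) i).continuous
  let g : ℝ → ℝ := fun s => F (tangent γ s 0 * derivWithin (derivWithin γ I) I s 1 -
    tangent γ s 1 * derivWithin (derivWithin γ I) I s 0)
  have hg : ContinuousOn g I := by
    refine hF.comp_continuousOn ?_
    exact ((hγ.continuous_tangent_apply 0).continuousOn.mul ((e 1).comp_continuousOn h2)).sub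
      ((hγ.continuous_tangent_apply 1).continuousOn.mul ((e 0).comp_continuousOn h2))
  refine (ContinuousOn.intervalIntegrable (by rwa [uIcc_of_le hlt.le])).congr_uIoo ?_
    (f := g)
  intro s hs
  rw [uIoo_of_le hlt.le] at hs
  have hev : ∀ v ∈ Ioo (t i) (t (i + 1)), derivWithin γ I v = tangent γ v := fun v hv =>
    derivWithin_of_mem_nhds (Icc_mem_nhds hv.1 hv.2)
  have h3 : derivWithin (derivWithin γ I) I s = deriv (tangent γ) s := by
    rw [derivWithin_of_mem_nhds (Icc_mem_nhds hs.1 hs.2)]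
    exact EventuallyEq.deriv_eq (Filter.eventually_of_mem (Ioo_mem_nhds hs.1 hs.2) hev)
  simp only [g, h3, curvature_eq]

theorem deriv_tangent_apply {u : ℝ} (hu : u ∉ singularSet γ) :
    deriv (tangent γ) u 0 = -(curvature γ u * tangent γ u 1) ∧
    deriv (tangent γ) u 1 = curvature γ u * tangent γ u 0 := by
  have h0 := hasDerivAt_apply (hasDerivAt_tangent hu) 0
  have h1 := hasDerivAt_apply (hasDerivAt_tangent hu) 1
  have h2 := (h0.pow 2).add (h1.pow 2)
  have h3 : HasDerivAt (fun s => tangent γ s 0 ^ 2 + tangent γ s 1 ^ 2) 0 u := by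
    simp only [hγ.tangent_sq]; exact hasDerivAt_const u 1
  have h4 := h2.unique h3
  have h5 := hγ.tangent_sq u
  rw [curvature_eq]
  norm_num at h4
  constructor
  · linear_combination (-deriv (tangent γ) u 0) * h5 + tangent γ u 0 / 2 * h4
  · linear_combination (-deriv (tangent γ) u 1) * h5 + tangent γ u 1 / 2 * h4

/-- The angle by which the tangent turns between the parameters `a` and `s`. -/
theorem exists_turning (a : ℝ) : ∃ φ : ℝ → ℝ, Continuous φ ∧ φ a = 0 ∧
    (∀ s t, φ t - φ s = ∫ u in s..t, curvature γ u) ∧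
    (∀ u ∉ singularSet γ, HasDerivAt φ (curvature γ u) u) ∧
    ∀ s, tangent γ s 0 = tangent γ a 0 * Real.cos (φ s) - tangent γ a 1 * Real.sin (φ s) ∧
      tangent γ s 1 = tangent γ a 0 * Real.sin (φ s) + tangent γ a 1 * Real.cos (φ s) := by
  have hi : ∀ c d, IntervalIntegrable (curvature γ) volume c d := fun c d =>
    hγ.intervalIntegrable_comp_curvature continuous_id c d
  set φ : ℝ → ℝ := fun s => ∫ u in a..s, curvature γ u with hφ
  have hc : Continuous φ := intervalIntegral.continuous_primitive hi a
  have h0 : φ a = 0 := intervalIntegral.integral_same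
  have hd : ∀ u ∉ singularSet γ, HasDerivAt φ (curvature γ u) u := fun u hu => by
    have hm : Measurable (curvature γ) := by
      have hk : curvature γ = fun s => tangent γ s 0 * deriv (tangent γ) s 1 -
        tangent γ s 1 * deriv (tangent γ) s 0 := funext (curvature_eq γ)
      have hm' : ∀ (f : ℝ → Plane) (i : Fin 2), Measurable fun s => deriv f s i := fun f i =>
        (EuclideanSpace.proj (𝕜 := ℝ) i).continuous.measurable.comp (measurable_deriv f)
      rw [hk]
      exact ((hm' γ 0).mul (hm' _ 1)).sub ((hm' γ 1).mul (hm' _ 0))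
    exact intervalIntegral.integral_hasDerivAt_right (hi a u)
      (hm.stronglyMeasurable.stronglyMeasurableAtFilter) (continuousAt_curvature hu)
  refine ⟨φ, hc, h0, fun s t => intervalIntegral.integral_interval_sub_left (hi a t) (hi a s), hd,
    fun s => ?_⟩
  refine eq_rotation_of_hasDerivAt (k := curvature γ) hγ.countable_singularSet
    (hγ.continuous_tangent_apply 0) (hγ.continuous_tangent_apply 1) hc h0 hd
    (fun u hu => ?_) (fun u hu => ?_) s
  · rw [← (hγ.deriv_tangent_apply hu).1]; exact hasDerivAt_apply (hasDerivAt_tangent hu) 0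
  · rw [← (hγ.deriv_tangent_apply hu).2]; exact hasDerivAt_apply (hasDerivAt_tangent hu) 1

/-- Outside a ball containing the curve, the outward radial ray from a point misses the curve, so
the component of that point is unbounded. This makes the enclosed area finite, so that `toReal`
loses nothing. -/
theorem isBounded_enclosedRegion : Bornology.IsBounded (enclosedRegion γ) := by
  have hr : range γ = γ '' Icc 0 L := by
    have h := hγ.periodic.image_Icc hγ.length_pos 0
    rw [zero_add] at h
    exact h.symm
  have hb : Bornology.IsBounded (range γ) := by
    rw [hr]; exact (isCompact_Icc.image hγ.continuous).isBounded
  obtain ⟨R, hR⟩ := hb.subset_closedBall 0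
  refine (Metric.isBounded_closedBall (x := (0 : Plane)) (r := max R 0)).subset fun x hx => ?_
  by_contra hx'
  rw [mem_closedBall_zero_iff, not_le] at hx'
  have hx0 : 0 < ‖x‖ := (le_max_right _ _).trans_lt hx'
  set ray := (fun ρ : ℝ => ρ • x) '' Ici 1
  have hconn : IsPreconnected ray := isPreconnected_Ici.image _ (by fun_prop)
  have hsub : ray ⊆ (range γ)ᶜ := by
    rintro _ ⟨ρ, hρ, rfl⟩ hmem
    have h1 := mem_closedBall_zero_iff.1 (hR hmem)
    rw [norm_smul, Real.norm_eq_abs, abs_of_nonneg (zero_le_one.trans hρ)] at h1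
    have h2 := le_mul_of_one_le_left hx0.le hρ
    linarith [le_max_left R 0]
  have hray := (hx.2.subset (hconn.subset_connectedComponentIn ⟨1, by simp, one_smul ℝ x⟩ hsub))
  obtain ⟨C, hC⟩ := hray.exists_norm_le
  have := hC _ ⟨max 1 ((C + 1) / ‖x‖), mem_Ici.2 (le_max_left _ _), rfl⟩
  rw [norm_smul, Real.norm_eq_abs, abs_of_nonneg (by positivity)] at this
  have h3 := mul_le_mul_of_nonneg_right (le_max_right 1 ((C + 1) / ‖x‖)) hx0.le
  rw [div_mul_cancel₀ _ hx0.ne'] at h3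
  linarith

end IsPositiveSimpleClosedCurve

/-- The linear map carrying the canonical basis to `(σ n, -t)`, where `t = (p, q)`. -/
def frameMap (σ p q : ℝ) : ℝ × ℝ →ₗ[ℝ] Plane where
  toFun w := !₂[-(σ * q * w.1) - p * w.2, σ * p * w.1 - q * w.2]
  map_add' v w := by ext i; fin_cases i <;> simp <;> ring
  map_smul' c v := by ext i; fin_cases i <;> simp <;> ring

theorem measurePreserving_frameMap {σ p q : ℝ} (hσ : σ ^ 2 = 1) (hpq : p ^ 2 + q ^ 2 = 1) :
    MeasurePreserving (frameMap σ p q) := by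
  let f : Plane →ₗ[ℝ] Plane :=
    { toFun := fun v => !₂[-(σ * q * v 0) - p * v 1, σ * p * v 0 - q * v 1]
      map_add' := fun v w => by ext i; fin_cases i <;> simp <;> ring
      map_smul' := fun c v => by ext i; fin_cases i <;> simp <;> ring }
  let g : Plane →ₗᵢ[ℝ] Plane :=
    { toLinearMap := f
      norm_map' := fun v => by
        rw [EuclideanSpace.norm_eq, EuclideanSpace.norm_eq]
        congr 1
        simp only [f, LinearMap.coe_mk, AddHom.coe_mk, Fin.sum_univ_two, Real.norm_eq_abs, sq_abs]
        simp
        linear_combination (v 0 ^ 2 * (p ^ 2 + q ^ 2)) * hσ + (v 0 ^ 2 + v 1 ^ 2) * hpq }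
  have h1 : MeasurePreserving g := (g.toLinearIsometryEquiv rfl).measurePreserving
  have h2 := (EuclideanSpace.volume_preserving_symm_measurableEquiv_toLp (Fin 2)).symm
  have h3 := (volume_preserving_finTwoArrow ℝ).symm
  have h4 := h1.comp (h2.comp h3)
  have e : ⇑(frameMap σ p q) = ⇑g ∘ ⇑(MeasurableEquiv.toLp 2 (Fin 2 → ℝ)).symm.symm ∘
      ⇑(MeasurableEquiv.finTwoArrow (α := ℝ)).symm := by
    ext w i; fin_cases i <;> rfl
  rw [e]
  exact h4

/-! ### Geometry of a single arc holding a convex set -/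

namespace ArcHolds

variable {γ : ℝ → Plane} {L a b : ℝ} {K : Set Plane}

theorem mem_frontier (hK : ArcHolds γ L a b K) {u : ℝ} (hu : u ∈ Icc a b) :
    γ u ∈ frontier K := by
  rw [hK.frontier_eq]; exact Or.inr ⟨u, hu, rfl⟩

theorem mem_closure (hK : ArcHolds γ L a b K) {u : ℝ} (hu : u ∈ Icc a b) : γ u ∈ closure K :=
  frontier_subset_closure (hK.mem_frontier hu)

theorem notMem (hK : ArcHolds γ L a b K) {u : ℝ} (hu : u ∈ Icc a b) : γ u ∉ K := by
  have h := hK.mem_frontier hu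
  rw [hK.isOpen.frontier_eq] at h
  exact h.2

theorem nonempty (hK : ArcHolds γ L a b K) : K.Nonempty :=
  closure_nonempty_iff.1 ⟨_, hK.mem_closure ⟨le_rfl, hK.lt.le⟩⟩

end ArcHolds

/-- The signed distance of `z` from the tangent line at `γ s`, positive on the left. -/
def offset (γ : ℝ → Plane) (s : ℝ) (z : Plane) : ℝ :=
  tangent γ s 0 * (z 1 - γ s 1) - tangent γ s 1 * (z 0 - γ s 0)

theorem dual_apply (f : StrongDual ℝ Plane) (v : Plane) :
    f v = v 0 * f !₂[1, 0] + v 1 * f !₂[0, 1] := by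
  conv_lhs => rw [show v = v 0 • !₂[1, 0] + v 1 • !₂[0, 1] by
    ext i; fin_cases i <;> simp]
  simp

namespace IsPositiveSimpleClosedCurve

variable {γ : ℝ → Plane} {L : ℝ} (hγ : IsPositiveSimpleClosedCurve γ L)
  {a b : ℝ} {K : Set Plane} (hK : ArcHolds γ L a b K)
include hγ hK

/-- `closure K` lies on one side of every tangent line of the arc. -/
theorem offset_mul_nonneg {s : ℝ} (hs : s ∈ Ioo a b) {z₀ : Plane} (hz₀ : z₀ ∈ K) :
    offset γ s z₀ ≠ 0 ∧ ∀ z ∈ closure K, 0 ≤ offset γ s z * offset γ s z₀ := by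
  obtain ⟨f, hf⟩ := geometric_hahn_banach_open_point hK.convex hK.isOpen
    (hK.notMem (Ioo_subset_Icc_self hs))
  have hf' : ∀ z ∈ closure K, f z ≤ f (γ s) := fun z hz =>
    closure_minimal (fun w hw => (hf w hw).le) (isClosed_Iic.preimage f.continuous) hz
  -- The supporting functional at γ s is maximal along the arc there, so it kills the tangent and is
  -- a multiple of `offset γ s` up to a constant.
  have hmax : IsLocalMax (fun u => f (γ u)) s :=
    Filter.eventually_of_mem (Ioo_mem_nhds hs.1 hs.2) fun u hu =>
      hf' _ (hK.mem_closure (Ioo_subset_Icc_self hu))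
  have hd : f (tangent γ s) = 0 :=
    hmax.hasDerivAt_eq_zero (f.hasFDerivAt.comp_hasDerivAt s (hγ.hasDerivAt s))
  set A := f !₂[1, 0]
  set B := f !₂[0, 1]
  set p := tangent γ s 0
  set q := tangent γ s 1
  have hpq : p ^ 2 + q ^ 2 = 1 := hγ.tangent_sq s
  have hd' : p * A + q * B = 0 := by rw [← hd, dual_apply f (tangent γ s)]
  have key : ∀ z, f z - f (γ s) = offset γ s z * (p * B - q * A) := by
    intro z
    rw [dual_apply f z, dual_apply f (γ s)]
    simp only [offset]
    linear_combination (-(z 0 - γ s 0) * A - (z 1 - γ s 1) * B) * hpq +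
      ((z 0 - γ s 0) * p + (z 1 - γ s 1) * q) * hd'
  have h0 : offset γ s z₀ * (p * B - q * A) < 0 := by
    rw [← key]; linarith [hf z₀ hz₀]
  refine ⟨fun h => by rw [h, zero_mul] at h0; exact h0.false, fun z hz => ?_⟩
  have h1 : offset γ s z * (p * B - q * A) ≤ 0 := by rw [← key]; linarith [hf' z hz]
  have h2 : 0 < (p * B - q * A) ^ 2 := by
    apply sq_pos_of_ne_zero
    intro h; rw [h, mul_zero] at h0; exact h0.false
  have h3 : 0 ≤ (offset γ s z * offset γ s z₀) * (p * B - q * A) ^ 2 := by nlinarith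
  exact nonneg_of_mul_nonneg_left h3 h2

/-- The offset of a fixed point of K never vanishes on the open arc, so by continuity its sign is
constant; σ records on which side of the tangents K lies. -/
theorem exists_orientation : ∃ σ : ℝ, (σ = 1 ∨ σ = -1) ∧
    ∀ s ∈ Ioo a b, ∀ z ∈ closure K, 0 ≤ σ * offset γ s z := by
  obtain ⟨z₀, hz₀⟩ := hK.nonempty
  have hc : Continuous fun s => offset γ s z₀ := by
    have h0 := hγ.continuous_tangent_apply 0
    have h1 := hγ.continuous_tangent_apply 1
    have h2 : ∀ i : Fin 2, Continuous fun s => γ s i := fun i =>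
      (EuclideanSpace.proj (𝕜 := ℝ) i).continuous.comp hγ.continuous
    exact (h0.mul (continuous_const.sub (h2 1))).sub (h1.mul (continuous_const.sub (h2 0)))
  by_cases h : ∀ s ∈ Ioo a b, 0 < offset γ s z₀
  · refine ⟨1, Or.inl rfl, fun s hs z hz => ?_⟩
    rw [one_mul]
    exact nonneg_of_mul_nonneg_left ((hγ.offset_mul_nonneg hK hs hz₀).2 z hz) (h s hs)
  · push Not at h
    obtain ⟨s₁, hs₁, hneg⟩ := h
    refine ⟨-1, Or.inr rfl, fun s hs z hz => ?_⟩
    have hs0 : offset γ s z₀ < 0 := by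
      by_contra hpos
      obtain ⟨c, hc1, hc2⟩ := isPreconnected_Ioo.intermediate_value hs₁ hs hc.continuousOn
        ⟨hneg, not_lt.1 hpos⟩
      exact (hγ.offset_mul_nonneg hK hc1 hz₀).1 hc2
    have := (hγ.offset_mul_nonneg hK hs hz₀).2 z hz
    nlinarith

/-- If σ k < 0 at s, then -σ times the offset of γ u has a local minimum 0 at s by the second
derivative test. Being also nonpositive, it vanishes near s, which contradicts its nonzero second
derivative. -/
theorem curvature_nonneg {σ : ℝ}
    (hσ : ∀ s ∈ Ioo a b, ∀ z ∈ closure K, 0 ≤ σ * offset γ s z) {s : ℝ} (hs : s ∈ Ioo a b)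
    (hsing : s ∉ singularSet γ) : 0 ≤ σ * curvature γ s := by
  by_contra hneg
  set h : ℝ → ℝ := fun u => -(σ * offset γ s (γ u)) with hh
  have hd : ∀ u, HasDerivAt h
      (-(σ * (tangent γ s 0 * tangent γ u 1 - tangent γ s 1 * tangent γ u 0))) u := fun u =>
    (((((hasDerivAt_apply (hγ.hasDerivAt u) 1).sub_const _).const_mul _).sub
      (((hasDerivAt_apply (hγ.hasDerivAt u) 0).sub_const _).const_mul _)).const_mul σ).neg
  have hd' : deriv h = fun u =>
      -(σ * (tangent γ s 0 * tangent γ u 1 - tangent γ s 1 * tangent γ u 0)) :=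
    funext fun u => (hd u).deriv
  have hdd : deriv (deriv h) s = -(σ * curvature γ s) := by
    rw [hd', curvature_eq]
    exact ((((hasDerivAt_apply (hasDerivAt_tangent hsing) 1).const_mul _).sub
      ((hasDerivAt_apply (hasDerivAt_tangent hsing) 0).const_mul _)).const_mul σ).neg.deriv
  have h0 : h s = 0 := by simp [hh, offset]
  have hmin : IsLocalMin h s := by
    refine isLocalMin_of_deriv_deriv_pos (by rw [hdd]; linarith) ?_ (hd s).continuousAt
    rw [hd']; ring
  have hz : h =ᶠ[𝓝 s] fun _ => 0 := by
    filter_upwards [hmin, Ioo_mem_nhds hs.1 hs.2] with u hu hu'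
    have := hσ s hs _ (hK.mem_closure (Ioo_subset_Icc_self hu'))
    rw [h0] at hu
    simp only [hh] at hu ⊢
    linarith
  have : deriv (deriv h) s = 0 := by
    rw [hz.deriv.deriv_eq]; simp
  rw [hdd] at this
  exact hneg (by linarith)

/-- Every line parallel to the kernel of f through a point of K leaves the bounded set K through its
frontier, so f would be constant on the open set K. This excludes straight arcs. -/
theorem not_frontier_subset_line (f : StrongDual ℝ Plane) (hf : f ≠ 0) (c : ℝ) :
    ¬∀ z ∈ frontier K, f z = c := by
  intro hc
  have hb : Bornology.IsBounded K := hγ.isBounded_enclosedRegion.subset hK.subset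
  set v : Plane := !₂[-f !₂[0, 1], f !₂[1, 0]] with hv
  have hfv : f v = 0 := by rw [dual_apply]; simp [hv]; ring
  have hv0 : v ≠ 0 := by
    intro h
    apply hf
    have h0 : v 0 = 0 := by rw [h]; rfl
    have h1 : v 1 = 0 := by rw [h]; rfl
    simp only [hv] at h0 h1
    ext z
    rw [dual_apply]
    simp at h0 h1
    simp [h0, h1]
  have hall : ∀ z ∈ K, f z = c := by
    intro z hz
    have hcont : Continuous fun ρ : ℝ => z + ρ • v := by fun_prop
    have hout : ∃ ρ : ℝ, z + ρ • v ∉ K := by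
      by_contra hin
      push Not at hin
      obtain ⟨C, hC⟩ := hb.exists_norm_le
      have hnv : 0 < ‖v‖ := norm_pos_iff.2 hv0
      have h1 := hC _ (hin ((‖z‖ + C + 1) / ‖v‖))
      have h2 : ‖((‖z‖ + C + 1) / ‖v‖) • v‖ = ‖z‖ + C + 1 := by
        have hC0 : 0 ≤ C := (norm_nonneg z).trans (hC z hz)
        rw [norm_smul, Real.norm_eq_abs, abs_of_nonneg (by positivity), div_mul_cancel₀ _ hnv.ne']
      have h3 := norm_sub_le (z + ((‖z‖ + C + 1) / ‖v‖) • v) z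
      rw [add_sub_cancel_left, h2] at h3
      linarith
    obtain ⟨ρ, hρ⟩ := hout
    obtain ⟨τ, hτ⟩ := nonempty_frontier_iff (s := (fun ρ : ℝ => z + ρ • v) ⁻¹' K).2
      ⟨⟨0, by simpa using hz⟩, fun h => hρ (h.ge (mem_univ ρ))⟩
    have := hc _ (hcont.frontier_preimage_subset K hτ)
    simpa [hfv] using this
  obtain ⟨z, hz⟩ := hK.nonempty
  have hopen := f.isOpenMap_of_ne_zero hf K hK.isOpen
  have himg : f '' K = {c} := by
    ext y; constructor
    · rintro ⟨w, hw, rfl⟩; exact hall w hw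
    · rintro rfl; exact ⟨z, hz, hall z hz⟩
  rw [himg] at hopen
  exact not_isOpen_singleton c hopen

/-- The arc of a cap turns by at least half a turn. -/
theorem exists_half_turn {σ : ℝ} (hσ1 : σ = 1 ∨ σ = -1)
    (hσ : ∀ s ∈ Ioo a b, ∀ z ∈ closure K, 0 ≤ σ * offset γ s z) {φ : ℝ → ℝ} (hc : Continuous φ)
    (h0 : φ a = 0) (hint : ∀ s t, φ t - φ s = ∫ u in s..t, curvature γ u)
    (hrot : ∀ s, tangent γ s 0 = tangent γ a 0 * Real.cos (φ s) - tangent γ a 1 * Real.sin (φ s) ∧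
      tangent γ s 1 = tangent γ a 0 * Real.sin (φ s) + tangent γ a 1 * Real.cos (φ s)) :
    MonotoneOn (fun u => σ * φ u) (Icc a b) ∧ ∃ c ∈ Ioc a b, σ * φ c = Real.pi := by
  have hmono : MonotoneOn (fun u => σ * φ u) (Icc a b) := by
    intro s hs t ht hst
    have h1 : σ * φ t - σ * φ s = ∫ u in s..t, σ * curvature γ u := by
      rw [intervalIntegral.integral_const_mul, ← hint]; ring
    have h2 : 0 ≤ ∫ u in s..t, σ * curvature γ u := by
      refine intervalIntegral.integral_nonneg_of_ae_restrict hst ?_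
      have hae : ∀ᵐ u : ℝ, u ∉ singularSet γ ∪ {a, b} :=
        (hγ.countable_singularSet.union (by simp)).ae_notMem volume
      filter_upwards [ae_restrict_of_ae hae, ae_restrict_mem measurableSet_Icc] with u hu hu'
      simp only [mem_union, mem_insert_iff, mem_singleton_iff, not_or] at hu
      exact hγ.curvature_nonneg hK hσ ⟨(hs.1.trans hu'.1).lt_of_ne' hu.2.1,
        (hu'.2.trans ht.2).lt_of_ne hu.2.2⟩ hu.1
    change σ * φ s ≤ σ * φ t
    linarith
  refine ⟨hmono, ?_⟩
  have hab := hK.lt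
  -- Without turning, arc and segment would both lie on one line.
  have hpos : 0 < σ * φ b := by
    by_contra hle
    have hzero : ∀ u ∈ Icc a b, φ u = 0 := by
      intro u hu
      have h1 := hmono ⟨le_rfl, hab.le⟩ hu hu.1
      have h2 := hmono hu ⟨hab.le, le_rfl⟩ hu.2
      simp only [h0, mul_zero] at h1 h2
      rcases hσ1 with rfl | rfl <;> linarith
    let f : StrongDual ℝ Plane := tangent γ a 0 • EuclideanSpace.proj 1 -
      tangent γ a 1 • EuclideanSpace.proj 0
    have hfapp : ∀ z, f z = tangent γ a 0 * z 1 - tangent γ a 1 * z 0 := fun z => by simp [f]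
    have hf : f ≠ 0 := by
      intro hf0
      have := hfapp !₂[-tangent γ a 1, tangent γ a 0]
      rw [hf0] at this
      simp at this
      nlinarith [hγ.tangent_sq a]
    have hline : ∀ u ∈ Icc a b, f (γ u) = f (γ a) := by
      intro u hu
      refine constant_of_has_deriv_right_zero (f := fun v => f (γ v))
        ((f.continuous.comp hγ.continuous).continuousOn) (fun v hv => ?_) u hu
      have h1 := (f.hasFDerivAt.comp_hasDerivAt v (hγ.hasDerivAt v))
      have h2 : f (tangent γ v) = 0 := by
        have := hrot v
        rw [hzero v (Ico_subset_Icc_self hv)] at this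
        simp only [Real.cos_zero, Real.sin_zero, mul_one, mul_zero, sub_zero, zero_add] at this
        rw [hfapp, this.1, this.2]; ring
      rw [h2] at h1
      exact h1.hasDerivWithinAt
    refine hγ.not_frontier_subset_line hK f hf (f (γ a)) fun z hz => ?_
    rw [hK.frontier_eq] at hz
    rcases hz with ⟨α, β, hα, hβ, hαβ, rfl⟩ | ⟨u, hu, rfl⟩
    · simp only [map_add, map_smul, hline b ⟨hab.le, le_rfl⟩, smul_eq_mul]
      rw [← add_mul, hαβ, one_mul]
    · exact hline u hu
  have hsin : Real.sin (φ b) = 0 := by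
    have h1 := hrot b
    have h2 := hγ.tangent_sq a
    have h3 : tangent γ a 0 * tangent γ b 1 - tangent γ a 1 * tangent γ b 0 = 0 := by
      rcases hK.parallel with h | h <;> rw [h] <;> simp <;> ring
    rw [h1.1, h1.2] at h3
    linear_combination h3 - Real.sin (φ b) * h2
  -- Parallel end tangents make the total turning a positive multiple of π. It may exceed π, so the
  -- arc is cut at the first-found parameter `c` where the turning equals π.
  have hpi : Real.pi ≤ σ * φ b := by
    obtain ⟨n, hn⟩ := Real.sin_eq_zero_iff.1 hsin
    by_contra hlt
    have hs0 : 0 < Real.sin (σ * φ b) := Real.sin_pos_of_pos_of_lt_pi hpos (not_le.1 hlt)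
    rcases hσ1 with rfl | rfl
    · rw [one_mul, hsin] at hs0; exact hs0.false
    · rw [neg_one_mul, Real.sin_neg, hsin, neg_zero] at hs0; exact hs0.false
  obtain ⟨c, hc1, hc2⟩ := intermediate_value_Icc hab.le
    (f := fun u => σ * φ u) (by fun_prop) (show Real.pi ∈ Icc (σ * φ a) (σ * φ b) by
      rw [h0, mul_zero]; exact ⟨Real.pi_pos.le, hpi⟩)
  refine ⟨c, ⟨hc1.1.lt_of_ne ?_, hc1.2⟩, hc2⟩
  rintro rfl
  simp only [h0, mul_zero] at hc2
  exact Real.pi_pos.ne hc2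

/-- The isoperimetric inequality for a single cap. -/
theorem pi_cubed_le_of_arcHolds :
    0 < (∫ u in a..b, curvature γ u ^ 2) ∧
    Real.pi ^ 3 ≤ 2 * (volume K).toReal * (∫ u in a..b, curvature γ u ^ 2) ^ 2 := by
  obtain ⟨σ, hσ1, hσ⟩ := hγ.exists_orientation hK
  obtain ⟨φ, hc, h0, hint, hd, hrot⟩ := hγ.exists_turning a
  obtain ⟨hmono, c, hac, hcπ⟩ := hγ.exists_half_turn hK hσ1 hσ hc h0 hint hrot
  have hσ2 : σ ^ 2 = 1 := by rcases hσ1 with rfl | rfl <;> norm_num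
  set p := tangent γ a 0
  set q := tangent γ a 1
  have hpq : p ^ 2 + q ^ 2 = 1 := hγ.tangent_sq a
  have hsub : Icc a c ⊆ Icc a b := Icc_subset_Icc_right hac.2
  -- Coordinates of γ in the frame (σ n, -t) at `a`: the cap then starts downwards and turns
  -- counterclockwise for either sign of σ. Subtracting `cX`, `cY` moves the midpoint of the chord
  -- to the origin.
  set X₀ : ℝ → ℝ := fun u => σ * (p * γ u 1 - q * γ u 0)
  set Y₀ : ℝ → ℝ := fun u => -(p * γ u 0 + q * γ u 1)
  set cX := (X₀ a + X₀ c) / 2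
  set cY := (Y₀ a + Y₀ c) / 2
  have hsc : ∀ t, Real.sin (σ * t) = σ * Real.sin t ∧ Real.cos (σ * t) = Real.cos t := by
    intro t; rcases hσ1 with rfl | rfl <;> simp
  have hcap : IsCap (fun u => X₀ u - cX) (fun u => Y₀ u - cY) (fun u => σ * φ u) a c :=
    { lt := hac.1
      cont := by fun_prop
      hasDerivAt_fst := fun u => by
        refine (((((hasDerivAt_apply (hγ.hasDerivAt u) 1).const_mul p).sub
          ((hasDerivAt_apply (hγ.hasDerivAt u) 0).const_mul q)).const_mul σ).sub_const
            cX).congr_deriv ?_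
        rw [(hrot u).1, (hrot u).2, (hsc _).1]
        linear_combination (σ * Real.sin (φ u)) * hpq
      hasDerivAt_snd := fun u => by
        refine ((((hasDerivAt_apply (hγ.hasDerivAt u) 0).const_mul p).add
          ((hasDerivAt_apply (hγ.hasDerivAt u) 1).const_mul q)).neg.sub_const
            cY).congr_deriv ?_
        rw [(hrot u).1, (hrot u).2, (hsc _).2]
        linear_combination (-Real.cos (φ u)) * hpq
      mono := hmono.mono hsub
      angle_left := by simp [h0]
      angle_right := hcπ
      symm_fst := by simp only [cX]; ring
      symm_snd := by simp only [cY]; ring }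
  have hi2 : ∀ d e, IntervalIntegrable (fun u => curvature γ u ^ 2) volume d e :=
    hγ.intervalIntegrable_comp_curvature (continuous_pow 2)
  have hsq : ∀ u, (σ * curvature γ u) ^ 2 = curvature γ u ^ 2 := fun u => by
    rw [mul_pow, hσ2, one_mul]
  obtain ⟨hP, hI, hle⟩ := hcap.pi_cubed_le (κ := fun u => σ * curvature γ u)
    hγ.countable_singularSet (fun u hu => (hd u hu).const_mul σ)
    ((hγ.intervalIntegrable_comp_curvature continuous_id a c).const_mul σ)
    (by simpa only [hsq] using hi2 a c)
  simp only [hsq] at hI hle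
  have hKc : Convex ℝ (closure K) := hK.convex.closure
  have hKm : MeasurableSet (closure K) := isClosed_closure.measurableSet
  have hb : Bornology.IsBounded K := hγ.isBounded_enclosedRegion.subset hK.subset
  have hvol : volume (closure K) = volume K := by
    rw [closure_eq_self_union_frontier]
    refine le_antisymm ((measure_union_le _ _).trans ?_) (measure_mono subset_union_left)
    rw [hK.convex.addHaar_frontier volume, add_zero]
  have hmp := measurePreserving_frameMap hσ2 hpq
  set C₀ := frameMap σ p q ⁻¹' closure K
  have hC₀ : volume C₀ = volume K := by
    rw [← hvol]; exact hmp.measure_preimage hKm.nullMeasurableSet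
  have harea := hcap.area_le (C := (fun w => (cX, cY) + w) ⁻¹' C₀)
    ((hKc.linear_preimage (frameMap σ p q)).translate_preimage_right _)
    (measurable_const_add _ (hmp.measurable hKm)) (fun u hu => by
      change frameMap σ p q ((cX, cY) + (X₀ u - cX, Y₀ u - cY)) ∈ closure K
      convert hK.mem_closure (hsub hu) using 1
      ext i
      fin_cases i
      · simp [frameMap, X₀, Y₀]
        linear_combination (q ^ 2 * γ u 0 - q * p * γ u 1) * hσ2 + γ u 0 * hpq
      · simp [frameMap, X₀, Y₀]
        linear_combination (p ^ 2 * γ u 1 - q * p * γ u 0) * hσ2 + γ u 1 * hpq)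
  rw [measure_preimage_add, hC₀, ENNReal.ofReal_le_iff_le_toReal hb.measure_lt_top.ne] at harea
  have hI' : (∫ u in a..c, curvature γ u ^ 2) ≤ ∫ u in a..b, curvature γ u ^ 2 := by
    rw [← intervalIntegral.integral_add_adjacent_intervals (hi2 a c) (hi2 c b)]
    linarith [intervalIntegral.integral_nonneg (μ := volume) (f := fun u => curvature γ u ^ 2)
      hac.2 fun u _ => sq_nonneg _]
  refine ⟨hI.trans_le hI', hle.trans ?_⟩
  gcongr
  linarith

end IsPositiveSimpleClosedCurve

/-! ### Combining two disjoint caps -/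

/-- The parameters that lie in `(a, b)` modulo `L`. -/
def periodicIoo (L a b : ℝ) : Set ℝ := {u | ∃ i : ℤ, u + i * L ∈ Ioo a b}

theorem measurableSet_periodicIoo (L a b : ℝ) : MeasurableSet (periodicIoo L a b) := by
  have : periodicIoo L a b = ⋃ i : ℤ, (fun u => u + i * L) ⁻¹' Ioo a b := by
    ext u; simp only [periodicIoo, mem_ofPred_eq, mem_iUnion, mem_preimage]
  rw [this]
  exact MeasurableSet.iUnion fun i => measurable_add_const _ measurableSet_Ioo

theorem add_mem_periodicIoo_iff {L a b u : ℝ} :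
    u + L ∈ periodicIoo L a b ↔ u ∈ periodicIoo L a b := by
  constructor
  · rintro ⟨i, hi⟩
    exact ⟨i + 1, by push_cast; convert hi using 1; ring⟩
  · rintro ⟨i, hi⟩
    exact ⟨i - 1, by push_cast; convert hi using 1; ring⟩

theorem intervalIntegrable_indicator {f : ℝ → ℝ} {c d : ℝ} {T : Set ℝ} (hT : MeasurableSet T)
    (hf : IntervalIntegrable f volume c d) : IntervalIntegrable (T.indicator f) volume c d :=
  ⟨hf.1.indicator hT, hf.2.indicator hT⟩

/-- An arc may pass through γ 0; by periodicity the indicator can be integrated over [a, a + L]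
instead of [0, L]. -/
theorem integral_le_integral_indicator_periodicIoo {f : ℝ → ℝ} {L a b : ℝ}
    (hf : Function.Periodic f L) (h0 : ∀ u, 0 ≤ f u)
    (hi : ∀ c d, IntervalIntegrable f volume c d) (hab : a ≤ b) (hb : b ≤ a + L) :
    ∫ u in a..b, f u ≤ ∫ u in (0 : ℝ)..L, (periodicIoo L a b).indicator f u := by
  set g := (periodicIoo L a b).indicator f
  have hg : Function.Periodic g L := fun u => by
    by_cases hu : u ∈ periodicIoo L a b
    · simp only [g]
      rw [indicator_of_mem hu, indicator_of_mem (add_mem_periodicIoo_iff.2 hu), hf u]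
    · simp only [g]
      rw [indicator_of_notMem hu, indicator_of_notMem fun h => hu (add_mem_periodicIoo_iff.1 h)]
  have hgi : ∀ c d, IntervalIntegrable g volume c d := fun c d =>
    intervalIntegrable_indicator (measurableSet_periodicIoo L a b) (hi c d)
  have h1 := hg.intervalIntegral_add_eq 0 a
  rw [zero_add] at h1
  rw [h1, ← intervalIntegral.integral_add_adjacent_intervals (hgi a b) (hgi b (a + L))]
  have h2 : 0 ≤ ∫ u in b..(a + L), g u :=
    intervalIntegral.integral_nonneg hb fun u _ => indicator_nonneg (fun v _ => h0 v) u
  have h3 : ∫ u in a..b, f u = ∫ u in a..b, g u := by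
    rw [intervalIntegral.integral_of_le hab, intervalIntegral.integral_of_le hab,
      integral_Ioc_eq_integral_Ioo, integral_Ioc_eq_integral_Ioo]
    refine setIntegral_congr_fun measurableSet_Ioo fun u hu => ?_
    exact (indicator_of_mem (show u ∈ periodicIoo L a b from ⟨0, by simpa using hu⟩) f).symm
  linarith

namespace IsPositiveSimpleClosedCurve

variable {γ : ℝ → Plane} {L : ℝ} (hγ : IsPositiveSimpleClosedCurve γ L)
  {a b a' b' : ℝ} {K K' : Set Plane} (hK : ArcHolds γ L a b K) (hK' : ArcHolds γ L a' b' K')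
include hγ hK hK'

/-- Two arcs holding disjoint convex sets overlap only along a straight line. -/
theorem curvature_eq_zero_of_disjoint (hdisj : Disjoint K K') {u : ℝ}
    (hu : u ∈ periodicIoo L a b) (hu' : u ∈ periodicIoo L a' b') (hs : u ∉ singularSet γ) :
    curvature γ u = 0 := by
  obtain ⟨f, c, hf, hf'⟩ := geometric_hahn_banach_open_open hK.convex hK.isOpen hK'.convex
    hK'.isOpen hdisj
  obtain ⟨i, hi⟩ := hu
  obtain ⟨j, hj⟩ := hu'
  -- Near u the curve lies in both closures, hence on the separating line; then f kills both t and
  -- t', and k ≠ 0 would force f = 0.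
  have hline : ∀ᶠ v in 𝓝 u, f (γ v) = c := by
    have ci : Continuous fun v : ℝ => v + i * L := by fun_prop
    have cj : Continuous fun v : ℝ => v + j * L := by fun_prop
    filter_upwards [ci.continuousAt.preimage_mem_nhds (Ioo_mem_nhds hi.1 hi.2),
      cj.continuousAt.preimage_mem_nhds (Ioo_mem_nhds hj.1 hj.2)] with v hv hv'
    refine le_antisymm ?_ ?_
    · rw [← hγ.periodic.int_mul i v]
      exact closure_minimal (fun w hw => (hf w hw).le) (isClosed_Iic.preimage f.continuous)
        (hK.mem_closure (Ioo_subset_Icc_self hv))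
    · rw [← hγ.periodic.int_mul j v]
      exact closure_minimal (fun w hw => (hf' w hw).le) (isClosed_Ici.preimage f.continuous)
        (hK'.mem_closure (Ioo_subset_Icc_self hv'))
  have h1 : ∀ᶠ v in 𝓝 u, f (tangent γ v) = 0 := by
    filter_upwards [hline.eventually_nhds] with v hv
    exact (f.hasFDerivAt.comp_hasDerivAt v (hγ.hasDerivAt v)).unique
      ((hasDerivAt_const v c).congr_of_eventuallyEq hv)
  have h2 : f (deriv (tangent γ) u) = 0 :=
    (f.hasFDerivAt.comp_hasDerivAt u (hasDerivAt_tangent hs)).unique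
      ((hasDerivAt_const u (0 : ℝ)).congr_of_eventuallyEq h1)
  have h3 := h1.self_of_nhds
  rw [dual_apply] at h2 h3
  rw [curvature_eq]
  by_contra hne
  have hA : f !₂[1, 0] = 0 := by
    apply (mul_eq_zero.1 (_ : f !₂[1, 0] * _ = 0)).resolve_right hne
    linear_combination deriv (tangent γ) u 1 * h3 - tangent γ u 1 * h2
  have hB : f !₂[0, 1] = 0 := by
    apply (mul_eq_zero.1 (_ : f !₂[0, 1] * _ = 0)).resolve_right hne
    linear_combination tangent γ u 0 * h2 - deriv (tangent γ) u 0 * h3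
  obtain ⟨z, hz⟩ := hK.nonempty
  obtain ⟨z', hz'⟩ := hK'.nonempty
  have h4 := hf z hz
  have h5 := hf' z' hz'
  rw [dual_apply, hA, hB] at h4 h5
  linarith

theorem integral_add_integral_le (hdisj : Disjoint K K') :
    (∫ u in a..b, curvature γ u ^ 2) + ∫ u in a'..b', curvature γ u ^ 2
      ≤ ∫ u in (0 : ℝ)..L, curvature γ u ^ 2 := by
  set f : ℝ → ℝ := fun u => curvature γ u ^ 2
  have hi : ∀ c d, IntervalIntegrable f volume c d :=
    hγ.intervalIntegrable_comp_curvature (continuous_pow 2)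
  have hp : Function.Periodic f L := fun u => by simp only [f, hγ.periodic_curvature u]
  have h0 : ∀ u, 0 ≤ f u := fun u => sq_nonneg _
  have h1 := integral_le_integral_indicator_periodicIoo hp h0 hi hK.lt.le hK.lt_add.le
  have h2 := integral_le_integral_indicator_periodicIoo hp h0 hi hK'.lt.le hK'.lt_add.le
  refine (add_le_add h1 h2).trans ?_
  have i1 := intervalIntegrable_indicator (measurableSet_periodicIoo L a b) (hi 0 L)
  have i2 := intervalIntegrable_indicator (measurableSet_periodicIoo L a' b') (hi 0 L)
  rw [← intervalIntegral.integral_add i1 i2]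
  refine intervalIntegral.integral_mono_ae hγ.length_pos.le (i1.add i2) (hi 0 L) ?_
  filter_upwards [hγ.countable_singularSet.ae_notMem volume] with u hu
  change (periodicIoo L a b).indicator f u + (periodicIoo L a' b').indicator f u ≤ f u
  by_cases hm : u ∈ periodicIoo L a b <;> by_cases hm' : u ∈ periodicIoo L a' b'
  · have : f u = 0 := by
      simp [f, hγ.curvature_eq_zero_of_disjoint hK hK' hdisj hm hm' hu]
    simp [hm, hm', this]
  · simp [hm, hm']
  · simp [hm, hm']
  · simp [hm, hm', h0 u]

theorem toReal_add_toReal_le (hdisj : Disjoint K K') :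
    (volume K).toReal + (volume K').toReal ≤ enclosedArea γ := by
  have hb := hγ.isBounded_enclosedRegion
  rw [← ENNReal.toReal_add (hb.subset hK.subset).measure_lt_top.ne
    (hb.subset hK'.subset).measure_lt_top.ne, ← measure_union hdisj hK'.isOpen.measurableSet]
  exact ENNReal.toReal_mono hb.measure_lt_top.ne (measure_mono (union_subset hK.subset hK'.subset))

end IsPositiveSimpleClosedCurve

/-- The case V = c / x², W = c / y² is the worst one, and (x⁻² + y⁻²)(x + y)² is smallest at x = y,
where it equals 8. -/
theorem eight_mul_le_add_mul_add_sq {V W x y c : ℝ} (hx : 0 < x) (hy : 0 < y) (hc : 0 ≤ c)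
    (hV : c ≤ V * x ^ 2) (hW : c ≤ W * y ^ 2) : 8 * c ≤ (V + W) * (x + y) ^ 2 := by
  have h1 : c / x ^ 2 ≤ V := (div_le_iff₀ (by positivity)).2 hV
  have h2 : c / y ^ 2 ≤ W := (div_le_iff₀ (by positivity)).2 hW
  have h3 : 8 * c ≤ (c / x ^ 2 + c / y ^ 2) * (x + y) ^ 2 := by
    rw [div_add_div _ _ (by positivity) (by positivity), div_mul_eq_mul_div,
      le_div_iff₀ (by positivity)]
    have h4 : 8 * (x ^ 2 * y ^ 2) ≤ (y ^ 2 + x ^ 2) * (x + y) ^ 2 := by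
      nlinarith [mul_nonneg (sq_nonneg (x - y)) (sq_nonneg (x + y)),
        mul_nonneg (mul_pos hx hy).le (sq_nonneg (x - y))]
    nlinarith
  refine h3.trans ?_
  gcongr

end ElasticCurve

end

theorem proposition2 (γ : ℝ → ElasticCurve.Plane) (L : ℝ)
    (hγ : ElasticCurve.IsPositiveSimpleClosedCurve γ L)
    (a b a' b' : ℝ) (K K' : Set ElasticCurve.Plane)
    (hK : ElasticCurve.ArcHolds γ L a b K) (hK' : ElasticCurve.ArcHolds γ L a' b' K')
    (hdisj : Disjoint K K') :
    ElasticCurve.enclosedArea γ * ElasticCurve.elasticEnergy γ L ^ 2 ≥ Real.pi ^ 3 := by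
  obtain ⟨hI, h1⟩ := hγ.pi_cubed_le_of_arcHolds hK
  obtain ⟨hI', h1'⟩ := hγ.pi_cubed_le_of_arcHolds hK'
  -- Here V and W are twice the areas of K and K', and the integral of k² is twice the energy, so
  -- the factor 8 cancels exactly.
  have h2 := ElasticCurve.eight_mul_le_add_mul_add_sq hI hI' (by positivity) h1 h1'
  have h3 := hγ.integral_add_integral_le hK hK' hdisj
  have h4 := hγ.toReal_add_toReal_le hK hK' hdisj
  have h5 := mul_le_mul h4 (pow_le_pow_left₀ (by linarith) h3 2) (by positivity)
    (ENNReal.toReal_nonneg)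
  rw [ElasticCurve.elasticEnergy]
  linarith
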